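/- Let $M$ be a three-dimensional smooth manifold with an almost paracontact metric structure $(\phi,\xi,\eta,g)$: smooth tensor fields, $g$ a pseudo-Riemannian metric of signature $(2,1)$, with $$\phi^2=\mathrm{Id}-\eta\otimes\xi,\qquad \eta(\xi)=1,\qquad g(\phi X,\phi Y)=-g(X,Y)+\eta(X)\eta(Y).$$ Let $\Phi(X,Y)=g(X,\phi Y)$, $h=\tfrac12\mathcal L_\xi\phi$, and let $\nabla$ be the Levi-Civita connection of $g$ with curvature $R_{XY}Z=\nabla_X\nabla_YZ-\nabla_Y\nabla_XZ-\nabla_{[X,Y]}Z$. Assume that the structure is almost paracosymplectic ($d\eta=0$ and $d\Phi=0$) but not paracosymplectic (it is not normal: $N_\phi-2\,d\eta\otimes\xi$ does not vanish identically, where $N_\phi$ is the Nijenhuis torsion of $\phi$), and that for real constants $\kappa,\mu$ it is a $(\kappa,\mu)$-space: $$R_{XY}\xi=\kappa(\eta(Y)X-\eta(X)Y)+\mu(\eta(Y)hX-\eta(X)hY)\quad\text{for all vector fields }X,Y.$$ Let $p\in M$ and suppose that on some neighbourhood of $p$ there is a smooth vector field $X$ with $\phi X=X$ and $hX\neq0$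 at every point. Then on some open neighbourhood $U$ of $p$ there are a smooth Artin frame $(\xi,E_1,E_2)$, i.e. a smooth frame with $$\phi E_1=E_1,\quad \phi E_2=-E_2,\quad g(\xi,E_1)=g(\xi,E_2)=0,\quad g(E_1,E_2)=1,$$ a smooth function $b$ and a constant $\epsilon\in\{1,-1\}$ such that on $U$ $$\nabla_\xi\xi=0,\quad \nabla_\xi E_1=-\tfrac{\mu}{2}E_1,\quad \nabla_\xi E_2=\tfrac{\mu}{2}E_2,$$ $$\nabla_{E_1}\xi=-\epsilon E_2,\quad \nabla_{E_1}E_1=bE_1+\epsilon\xi,\quad \nabla_{E_1}E_2=-bE_2,$$ $$\nabla_{E_2}\xi=\epsilon\kappa E_1,\quad \nabla_{E_2}E_1=0,\quad \nabla_{E_2}E_2=-\epsilon\kappa\,\xi,$$ and, if $\kappa\neq0$, then $b=0$ on $U$. -/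

import Mathlib

open scoped Manifold ContDiff Bundle

noncomputable section

/-- The model space of three-dimensional manifolds. -/
abbrev E3 : Type := EuclideanSpace ℝ (Fin 3)

namespace Paracontact

/-- (Not necessarily continuous) vector fields on a three-dimensional manifold. A local vector field
on an open set `U` is represented by a field whose values outside `U` are irrelevant. -/
abbrev VField (M : Type*) [TopologicalSpace M] [ChartedSpace E3 M] : Type _ :=
  (x : M) → TangentSpace (𝓡 3) x

/-- `X` is a smooth vector field on `U`. -/
def SmoothOn {M : Type*} [TopologicalSpace M] [ChartedSpace E3 M] [IsManifold (𝓡 3) ∞ M]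
    (X : VField M) (U : Set M) : Prop :=
  ContMDiffOn (𝓡 3) ((𝓡 3).prod 𝓘(ℝ, E3)) ∞ (fun x => Bundle.TotalSpace.mk' E3 x (X x)) U

/-- The Lie bracket `[X, Y]` of vector fields. -/
abbrev bracket {M : Type*} [TopologicalSpace M] [ChartedSpace E3 M]
    (X Y : VField M) : VField M := VectorField.mlieBracket (𝓡 3) X Y

/-- The derivative `X f` of a function along a vector field. -/
def dirDeriv {M : Type*} [TopologicalSpace M] [ChartedSpace E3 M]
    (X : VField M) (f : M → ℝ) (x : M) : ℝ := mvfderiv (𝓡 3) f x (X x)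

/-- An almost paracontact metric structure `(φ, ξ, η, g)` on a three-dimensional smooth manifold:
smooth tensor fields, with `g` a pseudo-Riemannian metric of signature `(2, 1)`. -/
structure AlmostParacontactMetric (M : Type*) [TopologicalSpace M] [ChartedSpace E3 M]
    [IsManifold (𝓡 3) ∞ M] where
  /-- the affinor -/
  φ : (x : M) → TangentSpace (𝓡 3) x →L[ℝ] TangentSpace (𝓡 3) x
  /-- the characteristic (Reeb) vector field -/
  ξ : VField M
  /-- the characteristic one-form -/
  η : (x : M) → TangentSpace (𝓡 3) x →L[ℝ] ℝ
  /-- the metric -/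
  g : (x : M) → TangentSpace (𝓡 3) x →L[ℝ] TangentSpace (𝓡 3) x →L[ℝ] ℝ
  smooth_φ : ContMDiff (𝓡 3) ((𝓡 3).prod 𝓘(ℝ, E3 →L[ℝ] E3)) ∞
    (fun x => Bundle.TotalSpace.mk' (E3 →L[ℝ] E3)
      (E := fun x : M => TangentSpace (𝓡 3) x →L[ℝ] TangentSpace (𝓡 3) x) x (φ x))
  smooth_ξ : SmoothOn ξ Set.univ
  smooth_η : ContMDiff (𝓡 3) ((𝓡 3).prod 𝓘(ℝ, E3 →L[ℝ] ℝ)) ∞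
    (fun x => Bundle.TotalSpace.mk' (E3 →L[ℝ] ℝ)
      (E := fun x : M => TangentSpace (𝓡 3) x →L[ℝ] ℝ) x (η x))
  smooth_g : ContMDiff (𝓡 3) ((𝓡 3).prod 𝓘(ℝ, E3 →L[ℝ] E3 →L[ℝ] ℝ)) ∞
    (fun x => Bundle.TotalSpace.mk' (E3 →L[ℝ] E3 →L[ℝ] ℝ)
      (E := fun x : M => TangentSpace (𝓡 3) x →L[ℝ] TangentSpace (𝓡 3) x →L[ℝ] ℝ) x (g x))
  g_symm : ∀ (x : M) (v w : TangentSpace (𝓡 3) x), g x v w = g x w v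
  g_signature : ∀ x : M, ∃ e : Module.Basis (Fin 3) ℝ (TangentSpace (𝓡 3) x),
    ∀ i j, g x (e i) (e j) = if i = j then (if i = 2 then -1 else 1) else 0
  φ_sq : ∀ (x : M) (v : TangentSpace (𝓡 3) x), φ x (φ x v) = v - η x v • ξ x
  η_ξ : ∀ x : M, η x (ξ x) = 1
  g_φ : ∀ (x : M) (v w : TangentSpace (𝓡 3) x),
    g x (φ x v) (φ x w) = - g x v w + η x v * η x w

/-- `∇` is the Levi-Civita connection of the pseudo-Riemannian metric `g`: a smooth affine
connection, torsion-free and compatible with `g`. Here `∇ Y x v` is `∇_v Y` at `x`. -/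
structure IsLeviCivita {M : Type*} [TopologicalSpace M] [ChartedSpace E3 M]
    [IsManifold (𝓡 3) ∞ M]
    (g : (x : M) → TangentSpace (𝓡 3) x →L[ℝ] TangentSpace (𝓡 3) x →L[ℝ] ℝ)
    (nabla : CovariantDerivative (𝓡 3) E3 (TangentSpace (𝓡 3) : M → Type _)) : Prop where
  smooth : CovariantDerivative.ContMDiffCovariantDerivative nabla ∞
  torsion_free : nabla.torsion = 0
  metric : ∀ (x : M) (Y Z : VField M),
    MDifferentiableAt (𝓡 3) ((𝓡 3).prod 𝓘(ℝ, E3))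
      (fun y => Bundle.TotalSpace.mk' E3 y (Y y)) x →
    MDifferentiableAt (𝓡 3) ((𝓡 3).prod 𝓘(ℝ, E3))
      (fun y => Bundle.TotalSpace.mk' E3 y (Z y)) x →
    ∀ v : TangentSpace (𝓡 3) x,
      mvfderiv (𝓡 3) (fun y => g y (Y y) (Z y)) x v
        = g x (nabla Y x v) (Z x) + g x (Y x) (nabla Z x v)

/-- The covariant derivative `∇_X Y` of vector fields. -/
def covDeriv {M : Type*} [TopologicalSpace M] [ChartedSpace E3 M] [IsManifold (𝓡 3) ∞ M]
    (nabla : CovariantDerivative (𝓡 3) E3 (TangentSpace (𝓡 3) : M → Type _))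
    (X Y : VField M) : VField M := fun x => nabla Y x (X x)

/-- The curvature `R_{XY} Z = ∇_X ∇_Y Z - ∇_Y ∇_X Z - ∇_{[X,Y]} Z`. -/
def curvature {M : Type*} [TopologicalSpace M] [ChartedSpace E3 M] [IsManifold (𝓡 3) ∞ M]
    (nabla : CovariantDerivative (𝓡 3) E3 (TangentSpace (𝓡 3) : M → Type _))
    (X Y Z : VField M) : VField M := fun x =>
  covDeriv nabla X (covDeriv nabla Y Z) x - covDeriv nabla Y (covDeriv nabla X Z) x
    - covDeriv nabla (bracket X Y) Z x

namespace AlmostParacontactMetric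

variable {M : Type*} [TopologicalSpace M] [ChartedSpace E3 M] [IsManifold (𝓡 3) ∞ M]

/-- The vector field `φ X`. -/
def phi (S : AlmostParacontactMetric M) (X : VField M) : VField M := fun x => S.φ x (X x)

/-- The tensor field `h = (1/2) L_ξ φ`, that is `h X = (1/2) ([ξ, φ X] - φ [ξ, X])`. -/
def h (S : AlmostParacontactMetric M) (X : VField M) : VField M := fun x =>
  (1 / 2 : ℝ) • (bracket S.ξ (S.phi X) x - S.phi (bracket S.ξ X) x)

/-- The function `η(X)`. -/
def eta (S : AlmostParacontactMetric M) (X : VField M) (x : M) : ℝ := S.η x (X x)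

/-- The fundamental form `Φ(X, Y) = g(X, φ Y)`. -/
def Phi (S : AlmostParacontactMetric M) (X Y : VField M) (x : M) : ℝ :=
  S.g x (X x) (S.φ x (Y x))

/-- `X η(Y) - Y η(X) - η([X, Y])`: the exterior derivative of `η` on vector fields (this is
`2 dη(X, Y)` in the convention where `dη` carries a factor `1/2`). -/
def extDerivEta (S : AlmostParacontactMetric M) (X Y : VField M) (x : M) : ℝ :=
  dirDeriv X (S.eta Y) x - dirDeriv Y (S.eta X) x - S.eta (bracket X Y) x

/-- The exterior derivative of the fundamental form on vector fields (`3 dΦ(X, Y, Z)` in the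
convention where `dΦ` carries a factor `1/3`). -/
def extDerivPhi (S : AlmostParacontactMetric M) (X Y Z : VField M) (x : M) : ℝ :=
  dirDeriv X (S.Phi Y Z) x + dirDeriv Y (S.Phi Z X) x + dirDeriv Z (S.Phi X Y) x
    - S.Phi (bracket X Y) Z x - S.Phi (bracket Y Z) X x - S.Phi (bracket Z X) Y x

/-- The Nijenhuis torsion `N_φ(X, Y) = φ²[X, Y] + [φX, φY] - φ([φX, Y] + [X, φY])`. -/
def nijenhuis (S : AlmostParacontactMetric M) (X Y : VField M) : VField M := fun x =>
  S.phi (S.phi (bracket X Y)) x + bracket (S.phi X) (S.phi Y) x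
    - S.φ x (bracket (S.phi X) Y x + bracket X (S.phi Y) x)

/-- The structure is almost paracosymplectic: `dη = 0` and `dΦ = 0`. -/
structure IsAlmostParacosymplectic (S : AlmostParacontactMetric M) : Prop where
  closed_eta : ∀ (U : Set M), IsOpen U → ∀ X Y : VField M, SmoothOn X U → SmoothOn Y U →
    ∀ x ∈ U, S.extDerivEta X Y x = 0
  closed_Phi : ∀ (U : Set M), IsOpen U → ∀ X Y Z : VField M,
    SmoothOn X U → SmoothOn Y U → SmoothOn Z U → ∀ x ∈ U, S.extDerivPhi X Y Z x = 0

/-- The structure is normal: `N_φ - 2 dη ⊗ ξ = 0`. -/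
def IsNormal (S : AlmostParacontactMetric M) : Prop :=
  ∀ (U : Set M), IsOpen U → ∀ X Y : VField M, SmoothOn X U → SmoothOn Y U →
    ∀ x ∈ U, S.nijenhuis X Y x - S.extDerivEta X Y x • S.ξ x = 0

/-- The structure is paracosymplectic: almost paracosymplectic and normal. -/
def IsParacosymplectic (S : AlmostParacontactMetric M) : Prop :=
  S.IsAlmostParacosymplectic ∧ S.IsNormal

/-- The `(κ, μ)`-condition, `nabla` being the Levi-Civita connection:
`R_{XY} ξ = κ (η(Y) X - η(X) Y) + μ (η(Y) hX - η(X) hY)` for all (local) vector fields. -/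
def IsKappaMuSpace (S : AlmostParacontactMetric M)
    (nabla : CovariantDerivative (𝓡 3) E3 (TangentSpace (𝓡 3) : M → Type _))
    (κ μ : ℝ) : Prop :=
  ∀ (U : Set M), IsOpen U → ∀ X Y : VField M, SmoothOn X U → SmoothOn Y U → ∀ x ∈ U,
    curvature nabla X Y S.ξ x
      = κ • (S.eta Y x • X x - S.eta X x • Y x) + μ • (S.eta Y x • S.h X x - S.eta X x • S.h Y x)

/-- `(ξ, E₁, E₂)` is an Artin frame on `U`. -/
structure IsArtinFrameOn (S : AlmostParacontactMetric M) (E₁ E₂ : VField M) (U : Set M) :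
    Prop where
  frame : IsLocalFrameOn (𝓡 3) E3 ∞ ![S.ξ, E₁, E₂] U
  φ_E₁ : ∀ x ∈ U, S.φ x (E₁ x) = E₁ x
  φ_E₂ : ∀ x ∈ U, S.φ x (E₂ x) = - E₂ x
  g_ξ_E₁ : ∀ x ∈ U, S.g x (S.ξ x) (E₁ x) = 0
  g_ξ_E₂ : ∀ x ∈ U, S.g x (S.ξ x) (E₂ x) = 0
  g_E₁_E₂ : ∀ x ∈ U, S.g x (E₁ x) (E₂ x) = 1

end AlmostParacontactMetric

end Paracontact

end

/-! The frame is the given field, rescaled. Since `dη = 0`, `[ξ, X]` has no `ξ`-component, so `hX`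
is the `(-1)`-eigenpart of `[ξ, X]`. Both `X` and `hX` are null and, `g` being nondegenerate, `g(X,
hX) ≠ 0`. With `ε` its sign near `p` and `f = |g(X, hX)|^(-1/2)`, the fields `E₁ = fX` and `E₂ = ε f
hX` form an Artin frame with `hE₁ = εE₂` (`exists_artinFrame`).

The pairings of an Artin frame are constant, so metric compatibility, vanishing torsion, `dη = 0`,
`dΦ = 0` and the value of `hE₁` are linear equations for the connection coefficients. They leave
four unknowns `b, m, e, q` (`IsArtinFrameOn.connection`). The curvature identity then gives, with
`ε² = 1`, `R(ξ, E₁)ξ = 2εm E₂ - εe E₁ = -κE₁ - μεE₂`, hence `m = -μ/2` and `e = εκ`; `R(E₁, E₂)ξ =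
2εκb E₁ - 2εq E₂ = 0`, hence `q = 0` and `κb = 0`. Only `b = g(∇_{E₁}E₁, E₂)` stays free, and only
when `κ = 0`. -/

noncomputable section

namespace Paracontact

variable {M : Type*} [TopologicalSpace M] [ChartedSpace E3 M] [IsManifold (𝓡 3) ∞ M]

/-! ### Smooth vector fields -/

/-- The vector field `X` is differentiable at `x`. -/
abbrev DiffAt (X : VField M) (x : M) : Prop :=
  MDifferentiableAt (𝓡 3) ((𝓡 3).prod 𝓘(ℝ, E3)) (fun y => Bundle.TotalSpace.mk' E3 y (X y)) x

variable (M) in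
lemma isManifold_minSmoothness_two : IsManifold (𝓡 3) (minSmoothness ℝ 2) M := by
  rw [minSmoothness_of_isRCLikeNormedField]; infer_instance

omit [IsManifold (𝓡 3) ∞ M] in
lemma finrank_tangentSpace (x : M) : Module.finrank ℝ (TangentSpace (𝓡 3) x) = 3 :=
  finrank_euclideanSpace_fin (𝕜 := ℝ) (n := 3)

lemma SmoothOn.mono {X : VField M} {U V : Set M} (hX : SmoothOn X V) (h : U ⊆ V) :
    SmoothOn X U :=
  ContMDiffOn.mono hX h

lemma SmoothOn.contMDiffAt {X : VField M} {U : Set M} (hX : SmoothOn X U) (hU : IsOpen U)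
    {x : M} (hx : x ∈ U) : 
    ContMDiffAt (𝓡 3) ((𝓡 3).prod 𝓘(ℝ, E3)) ∞ (fun y => Bundle.TotalSpace.mk' E3 y (X y)) x :=
  ContMDiffOn.contMDiffAt hX (hU.mem_nhds hx)

lemma SmoothOn.mdifferentiableAt {X : VField M} {U : Set M} (hX : SmoothOn X U) (hU : IsOpen U)
    {x : M} (hx : x ∈ U) : DiffAt X x :=
  (hX.contMDiffAt hU hx).mdifferentiableAt (by simp)

lemma SmoothOn.congr {X Y : VField M} {U : Set M} (hX : SmoothOn X U)
    (h : ∀ x ∈ U, Y x = X x) : SmoothOn Y U :=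
  ContMDiffOn.congr hX fun x hx => by simp [h x hx]

lemma SmoothOn.bracket {X Y : VField M} {U : Set M} (hU : IsOpen U) (hX : SmoothOn X U)
    (hY : SmoothOn Y U) : SmoothOn (bracket X Y) U := by
  intro x hx
  have := isManifold_minSmoothness_two M
  have : IsManifold (𝓡 3) (((⊤ : ℕ∞) : ℕ∞ω) + 1) M := by simpa using ‹IsManifold (𝓡 3) ∞ M›
  exact (ContMDiffAt.mlieBracket_vectorField (m := ⊤) (n := ⊤) (hX.contMDiffAt hU hx)
    (hY.contMDiffAt hU hx) (by simp)).contMDiffWithinAt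

lemma SmoothOn.smul {f : M → ℝ} {X : VField M} {U : Set M} (hf : ContMDiffOn (𝓡 3) 𝓘(ℝ, ℝ) ∞ f U)
    (hX : SmoothOn X U) : SmoothOn (fun x => f x • X x) U :=
  ContMDiffOn.smul_section hf hX

lemma SmoothOn.sub {X Y : VField M} {U : Set M} (hX : SmoothOn X U)
    (hY : SmoothOn Y U) : SmoothOn (fun x => X x - Y x) U :=
  ContMDiffOn.sub_section hX hY

lemma SmoothOn.const_smul (c : ℝ) {X : VField M} {U : Set M}
    (hX : SmoothOn X U) : SmoothOn (fun x => c • X x) U :=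
  ContMDiffOn.const_smul_section hX

/-- Applying a smooth endomorphism field to a smooth vector field. -/
lemma SmoothOn.clm_apply
    {A : (x : M) → TangentSpace (𝓡 3) x →L[ℝ] TangentSpace (𝓡 3) x} {X : VField M} {U : Set M}
    (hA : ContMDiff (𝓡 3) ((𝓡 3).prod 𝓘(ℝ, E3 →L[ℝ] E3)) ∞
      (fun x => Bundle.TotalSpace.mk' (E3 →L[ℝ] E3)
        (E := fun x : M => TangentSpace (𝓡 3) x →L[ℝ] TangentSpace (𝓡 3) x) x (A x)))
    (hX : SmoothOn X U) : SmoothOn (fun x => A x (X x)) U :=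
  ContMDiffOn.clm_bundle_apply (hA.contMDiffOn) hX

omit [IsManifold (𝓡 3) ∞ M] in
/-- A derivative of a locally constant function vanishes. -/
lemma mvfderiv_eq_zero_of_eqOn_const {f : M → ℝ} {c : ℝ} {U : Set M} (hU : IsOpen U)
    (hf : ∀ y ∈ U, f y = c) {x : M} (hx : x ∈ U) (v : TangentSpace (𝓡 3) x) :
    mvfderiv (𝓡 3) f x v = 0 := by
  have h : f =ᶠ[nhds x] fun _ => c := Filter.eventuallyEq_of_mem (hU.mem_nhds hx) hf
  simp only [mvfderiv, h.mfderiv_eq, mfderiv_const]; rfl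

/-! ### Pointwise algebra of `(φ, ξ, η, g)` -/

namespace AlmostParacontactMetric

variable (S : AlmostParacontactMetric M)

/-- Since `φ²ξ = 0`, the formula for `φ²` at `φξ` gives `φξ = cξ` with `c = η(φξ)`. Applying `φ`
again gives `cφξ = 0`, and either factor being zero suffices. -/
lemma φ_ξ (x : M) : S.φ x (S.ξ x) = 0 := by
  have h1 : S.φ x (S.φ x (S.ξ x)) = 0 := by simp [S.φ_sq, S.η_ξ]
  have h2 := S.φ_sq x (S.φ x (S.ξ x))
  rw [h1, map_zero] at h2
  have h3 : S.φ x (S.ξ x) = S.η x (S.φ x (S.ξ x)) • S.ξ x := (sub_eq_zero.1 h2.symm)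
  have h4 := congrArg (S.φ x) h3
  rw [h1, map_smul] at h4
  rcases smul_eq_zero.1 h4.symm with h | h
  · rw [h3, h, zero_smul]
  · exact h

/-- Computing `φ³v` as `φ²(φv)` and as `φ(φ²v)` gives results that differ by `η(φv)ξ`. -/
lemma η_φ (x : M) (v : TangentSpace (𝓡 3) x) : S.η x (S.φ x v) = 0 := by
  have h1 := S.φ_sq x (S.φ x v)
  rw [S.φ_sq x v, map_sub, map_smul, S.φ_ξ, smul_zero, sub_zero] at h1
  have h2 : S.η x (S.φ x v) • S.ξ x = 0 := by
    rw [eq_comm, sub_eq_self] at h1; exact h1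
  have h3 := congrArg (S.η x) h2
  simpa [S.η_ξ] using h3

lemma g_ξ_right (x : M) (v : TangentSpace (𝓡 3) x) : S.g x v (S.ξ x) = S.η x v := by
  have h := S.g_φ x v (S.ξ x)
  rw [S.φ_ξ, map_zero, S.η_ξ] at h
  linarith

lemma g_φ_left (x : M) (v w : TangentSpace (𝓡 3) x) :
    S.g x (S.φ x v) w = - S.g x v (S.φ x w) := by
  have h := S.g_φ x v (S.φ x w)
  rw [S.φ_sq, map_sub, map_smul, S.g_ξ_right, S.η_φ, S.η_φ] at h
  simpa using h

lemma η_eq_zero_of_φ_eq {x : M} {v : TangentSpace (𝓡 3) x} {c : ℝ} (hc : c ≠ 0)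
    (hv : S.φ x v = c • v) : S.η x v = 0 := by
  have h := S.η_φ x v
  rw [hv, map_smul, smul_eq_mul] at h
  exact (mul_eq_zero.1 h).resolve_left hc

lemma g_self_eq_zero_of_φ_eq {x : M} {v : TangentSpace (𝓡 3) x} {c : ℝ} (hc : c ≠ 0)
    (hv : S.φ x v = c • v) : S.g x v v = 0 := by
  have h := S.g_φ_left x v v
  rw [hv, map_smul, map_smul, smul_apply, smul_eq_mul] at h
  have : c * S.g x v v = 0 := by linarith
  exact (mul_eq_zero.1 this).resolve_left hc

/-- The metric is nondegenerate. -/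
lemma eq_zero_of_g_eq_zero {x : M} {v : TangentSpace (𝓡 3) x}
    (hv : ∀ w, S.g x v w = 0) : v = 0 := by
  obtain ⟨e, he⟩ := S.g_signature x
  have h : ∀ j, e.repr v j = 0 := by
    intro j
    have h1 := hv (e j)
    rw [← e.sum_repr v] at h1
    simp only [map_sum, map_smul, sum_apply, smul_apply,
      he, smul_eq_mul, mul_ite, mul_zero, Finset.sum_ite_eq', Finset.mem_univ, if_true] at h1
    split_ifs at h1 <;> linarith
  exact e.repr.map_eq_zero_iff.1 (Finsupp.ext h)

/-- Nonzero eigenvectors for the eigenvalues `0, 1, -1` of `φ` are linearly independent. -/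
lemma linearIndependent_of_φ {x : M} {v w : TangentSpace (𝓡 3) x} (hv : S.φ x v = v)
    (hw : S.φ x w = -w) (hv0 : v ≠ 0) (hw0 : w ≠ 0) :
    LinearIndependent ℝ ![S.ξ x, v, w] := by
  have hηv : S.η x v = 0 := S.η_eq_zero_of_φ_eq one_ne_zero (by simpa using hv)
  have hηw : S.η x w = 0 := S.η_eq_zero_of_φ_eq (c := -1) (by norm_num) (by simpa using hw)
  rw [Fintype.linearIndependent_iff]
  intro a ha
  simp only [Fin.sum_univ_three, Matrix.cons_val_zero, Matrix.cons_val_one, Matrix.cons_val] at ha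
  have h0 : a 0 = 0 := by
    simpa [S.η_ξ, hηv, hηw] using congrArg (S.η x) ha
  rw [h0, zero_smul, zero_add] at ha
  have h1 := congrArg (S.φ x) ha
  simp only [map_add, map_smul, hv, hw, map_zero, smul_neg] at h1
  have h2 : (2 * a 1) • v = 0 := by
    have := congrArg₂ (· + ·) ha h1
    simp only [add_zero] at this
    rw [← this]; module
  have h3 : (2 * a 2) • w = 0 := by
    have := congrArg₂ (· - ·) ha h1
    simp only [sub_zero] at this
    rw [← this]; module
  have h4 : a 1 = 0 := by simpa [hv0] using h2
  have h5 : a 2 = 0 := by simpa [hw0] using h3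
  intro i
  fin_cases i
  exacts [h0, h4, h5]

lemma span_of_φ {x : M} {v w : TangentSpace (𝓡 3) x} (hv : S.φ x v = v)
    (hw : S.φ x w = -w) (hv0 : v ≠ 0) (hw0 : w ≠ 0) :
    Submodule.span ℝ (Set.range ![S.ξ x, v, w]) = ⊤ :=
  have : FiniteDimensional ℝ (TangentSpace (𝓡 3) x) := inferInstanceAs (FiniteDimensional ℝ E3)
  (S.linearIndependent_of_φ hv hw hv0 hw0).span_eq_top_of_card_eq_finrank'
    (by rw [finrank_tangentSpace]; rfl)

lemma exists_coeff_of_φ {x : M} {v w : TangentSpace (𝓡 3) x} (hv : S.φ x v = v)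
    (hw : S.φ x w = -w) (hv0 : v ≠ 0) (hw0 : w ≠ 0) (u : TangentSpace (𝓡 3) x) :
    ∃ a b c : ℝ, u = a • S.ξ x + b • v + c • w := by
  have hu : u ∈ Submodule.span ℝ (Set.range ![S.ξ x, v, w]) := by
    rw [S.span_of_φ hv hw hv0 hw0]; trivial
  obtain ⟨c, hc⟩ := (Submodule.mem_span_range_iff_exists_fun ℝ).1 hu
  refine ⟨c 0, c 1, c 2, ?_⟩
  simpa [Fin.sum_univ_three] using hc.symm

/-- The two null eigendirections of `φ` are paired by the metric. -/
lemma g_ne_zero_of_φ {x : M} {v w : TangentSpace (𝓡 3) x} (hv : S.φ x v = v)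
    (hw : S.φ x w = -w) (hv0 : v ≠ 0) (hw0 : w ≠ 0) : S.g x v w ≠ 0 := by
  intro h
  refine hv0 (S.eq_zero_of_g_eq_zero fun u => ?_)
  obtain ⟨a, b, c, rfl⟩ := S.exists_coeff_of_φ hv hw hv0 hw0 u
  simp [S.g_ξ_right, S.η_eq_zero_of_φ_eq (v := v) one_ne_zero (by simpa using hv), h,
    S.g_self_eq_zero_of_φ_eq (v := v) one_ne_zero (by simpa using hv)]

/-- The expansion of a tangent vector in an Artin basis. -/
lemma eq_artin_expansion {x : M} {v w : TangentSpace (𝓡 3) x} (hv : S.φ x v = v)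
    (hw : S.φ x w = -w) (hvw : S.g x v w = 1) (u : TangentSpace (𝓡 3) x) :
    u = S.g x u (S.ξ x) • S.ξ x + S.g x u w • v + S.g x u v • w := by
  have hv0 : v ≠ 0 := by rintro rfl; simp at hvw
  have hw0 : w ≠ 0 := by rintro rfl; simp at hvw
  have hv' : S.φ x v = (1 : ℝ) • v := by simpa using hv
  have hw' : S.φ x w = (-1 : ℝ) • w := by simpa using hw
  have hηv := S.η_eq_zero_of_φ_eq one_ne_zero hv'
  have hηw := S.η_eq_zero_of_φ_eq (by norm_num) hw'
  have hξv : S.g x (S.ξ x) v = 0 := by rw [S.g_symm, S.g_ξ_right, hηv]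
  have hξw : S.g x (S.ξ x) w = 0 := by rw [S.g_symm, S.g_ξ_right, hηw]
  have hwv : S.g x w v = 1 := by rw [S.g_symm, hvw]
  obtain ⟨a, b, c, rfl⟩ := S.exists_coeff_of_φ hv hw hv0 hw0 u
  simp [S.g_ξ_right, S.η_ξ, hηv, hηw, hξv, hξw, hvw, hwv,
    S.g_self_eq_zero_of_φ_eq one_ne_zero hv', S.g_self_eq_zero_of_φ_eq (by norm_num) hw']

/-! ### Smoothness -/

lemma smoothOn_ξ (U : Set M) : SmoothOn S.ξ U := S.smooth_ξ.mono (Set.subset_univ U)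

variable {S} in
lemma _root_.Paracontact.SmoothOn.phi {X : VField M} {U : Set M} (hX : SmoothOn X U) :
    SmoothOn (S.phi X) U :=
  hX.clm_apply S.smooth_φ

variable {S} in
lemma _root_.Paracontact.SmoothOn.h {X : VField M} {U : Set M} (hU : IsOpen U)
    (hX : SmoothOn X U) : SmoothOn (S.h X) U :=
  (((S.smoothOn_ξ U).bracket hU (SmoothOn.phi hX)).sub
    (SmoothOn.phi ((S.smoothOn_ξ U).bracket hU hX))).const_smul _

lemma contMDiffOn_g {X Y : VField M} {U : Set M} (hX : SmoothOn X U) (hY : SmoothOn Y U) :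
    ContMDiffOn (𝓡 3) 𝓘(ℝ, ℝ) ∞ (fun x => S.g x (X x) (Y x)) U := by
  intro x hx
  have h : ContMDiffWithinAt (𝓡 3) ((𝓡 3).prod 𝓘(ℝ)) ∞
      (fun m ↦ Bundle.TotalSpace.mk' ℝ (E := Bundle.Trivial M ℝ) m (S.g m (X m) (Y m))) U x := by
    apply ContMDiffWithinAt.clm_bundle_apply₂ (F₁ := E3) (F₂ := E3)
    · exact S.smooth_g.contMDiffAt.contMDiffWithinAt
    · exact hX x hx
    · exact hY x hx
  simp only [Bundle.contMDiffWithinAt_totalSpace] at h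
  exact h.2

lemma mdifferentiableAt_phi {X : VField M} {x : M} (hX : DiffAt X x) :
    DiffAt (S.phi X) x :=
  MDifferentiableAt.clm_bundle_apply (ContMDiff.mdifferentiable S.smooth_φ (by simp) x) hX

/-- The tensor `h` is tensorial. -/
lemma tensorialAt_h (x : M) : TensorialAt (𝓡 3) E3 (fun X => S.h X x) x where
  smul {f X} hf hX := by
    have := isManifold_minSmoothness_two M
    have h1 : S.phi (f • X) = f • S.phi X := by
      funext y; simp [phi]
    -- Each of the two brackets contributes the derivative term `(ξf) φX`, with opposite signs.
    simp only [h, bracket, h1,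
      VectorField.mlieBracket_smul_right hf (S.mdifferentiableAt_phi hX)]
    simp only [phi, VectorField.mlieBracket_smul_right hf hX, map_add, map_smul]
    module
  add {X Y} hX hY := by
    have := isManifold_minSmoothness_two M
    have h1 : S.phi (X + Y) = S.phi X + S.phi Y := by
      funext y; simp [phi]
    simp only [h, bracket, h1,
      VectorField.mlieBracket_add_right (S.mdifferentiableAt_phi hX) (S.mdifferentiableAt_phi hY)]
    simp only [phi, VectorField.mlieBracket_add_right hX hY, map_add]
    module

end AlmostParacontactMetric
end Paracontact
end

noncomputable section

namespace Paracontact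

variable {M : Type*} [TopologicalSpace M] [ChartedSpace E3 M] [IsManifold (𝓡 3) ∞ M]

namespace AlmostParacontactMetric

variable {S : AlmostParacontactMetric M}

/-! ### Consequences of the closedness of the structure forms -/

lemma IsAlmostParacosymplectic.η_bracket_eq_zero (hS : S.IsAlmostParacosymplectic) {U : Set M}
    (hU : IsOpen U) {X Y : VField M} (hX : SmoothOn X U) (hY : SmoothOn Y U) {a b : ℝ}
    (ha : ∀ x ∈ U, S.η x (X x) = a) (hb : ∀ x ∈ U, S.η x (Y x) = b) {x : M} (hx : x ∈ U) :
    S.η x (bracket X Y x) = 0 := by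
  have h := hS.closed_eta U hU X Y hX hY x hx
  simp only [extDerivEta, dirDeriv] at h
  rw [mvfderiv_eq_zero_of_eqOn_const hU (f := S.eta Y) hb hx,
    mvfderiv_eq_zero_of_eqOn_const hU (f := S.eta X) ha hx] at h
  simpa [eta] using h

/-- The bracket depends only on germs, and the eigenvalue is constant, so no derivative of it
appears. -/
lemma bracket_phi_eq {X Y : VField M} {U : Set M} (hU : IsOpen U) {a : ℝ}
    (hY : ∀ x ∈ U, S.φ x (Y x) = a • Y x) (hYs : SmoothOn Y U) {x : M} (hx : x ∈ U) :
    bracket X (S.phi Y) x = a • bracket X Y x := by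
  have := isManifold_minSmoothness_two M
  have h : S.phi Y =ᶠ[nhds x] a • Y := Filter.eventuallyEq_of_mem (hU.mem_nhds hx) hY
  rw [bracket, Filter.EventuallyEq.rfl.mlieBracket_vectorField_eq h]
  exact VectorField.mlieBracket_const_smul_right (hYs.mdifferentiableAt hU hx)

/-- If `φ X = X` and `dη = 0` then `hX` is the `(-1)`-eigencomponent of `[ξ, X]`. -/
lemma φ_h_of_φ_eq (hS : S.IsAlmostParacosymplectic) {X : VField M} {U : Set M} (hU : IsOpen U)
    (hX : SmoothOn X U) (hφX : ∀ x ∈ U, S.φ x (X x) = X x) {x : M} (hx : x ∈ U) :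
    S.φ x (S.h X x) = - S.h X x := by
  have hη : ∀ y ∈ U, S.η y (X y) = 0 := fun y hy =>
    S.η_eq_zero_of_φ_eq one_ne_zero (by simpa using hφX y hy)
  have h1 := hS.η_bracket_eq_zero hU (S.smoothOn_ξ U) hX (fun y _ => S.η_ξ y) hη hx
  have h2 := S.bracket_phi_eq (X := S.ξ) (a := 1) hU (by simpa using hφX) hX hx
  simp only [h, h2, phi, map_smul, map_sub, S.φ_sq, h1]
  module

/-! ### The Levi-Civita connection in an Artin frame -/

variable {nabla : CovariantDerivative (𝓡 3) E3 (TangentSpace (𝓡 3) : M → Type _)}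

/-- Turns metric compatibility into linear relations between connection coefficients, as every
pairing of Artin frame fields is constant. -/
lemma _root_.Paracontact.IsLeviCivita.metric_const (hLC : IsLeviCivita S.g nabla) {U : Set M}
    (hU : IsOpen U) {X Y : VField M} (hX : SmoothOn X U) (hY : SmoothOn Y U) {a : ℝ}
    (ha : ∀ x ∈ U, S.g x (X x) (Y x) = a) {x : M} (hx : x ∈ U) (v : TangentSpace (𝓡 3) x) :
    S.g x (nabla X x v) (Y x) + S.g x (nabla Y x v) (X x) = 0 := by
  rw [S.g_symm x (nabla Y x v), ← hLC.metric x X Y (hX.mdifferentiableAt hU hx)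
    (hY.mdifferentiableAt hU hx), mvfderiv_eq_zero_of_eqOn_const hU ha hx]

lemma _root_.Paracontact.IsLeviCivita.bracket_eq
    {g : (x : M) → TangentSpace (𝓡 3) x →L[ℝ] TangentSpace (𝓡 3) x →L[ℝ] ℝ}
    (hLC : IsLeviCivita g nabla) {U : Set M}
    (hU : IsOpen U) {X Y : VField M} (hX : SmoothOn X U) (hY : SmoothOn Y U)
    {x : M} (hx : x ∈ U) :
    bracket X Y x = nabla Y x (X x) - nabla X x (Y x) :=
  (CovariantDerivative.torsion_eq_zero_iff nabla |>.1 hLC.torsion_free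
    (hX.mdifferentiableAt hU hx) (hY.mdifferentiableAt hU hx)).symm

lemma IsArtinFrameOn.smoothOn₁ {E₁ E₂ : VField M} {U : Set M} (hF : S.IsArtinFrameOn E₁ E₂ U) :
    SmoothOn E₁ U := hF.frame.contMDiffOn 1

lemma IsArtinFrameOn.smoothOn₂ {E₁ E₂ : VField M} {U : Set M} (hF : S.IsArtinFrameOn E₁ E₂ U) :
    SmoothOn E₂ U := hF.frame.contMDiffOn 2

/-- The Levi-Civita connection of an almost paracosymplectic structure in an Artin frame. -/
lemma IsArtinFrameOn.connection {E₁ E₂ : VField M} {U : Set M} (hF : S.IsArtinFrameOn E₁ E₂ U)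
    (hU : IsOpen U) (hLC : IsLeviCivita S.g nabla) (hS : S.IsAlmostParacosymplectic)
    {c : ℝ} {x : M} (hx : x ∈ U) (hh : S.h E₁ x = c • E₂ x) :
    ∃ b m e q : ℝ, b = S.g x (nabla E₁ x (E₁ x)) (E₂ x) ∧
      nabla S.ξ x (S.ξ x) = 0 ∧ nabla E₁ x (S.ξ x) = m • E₁ x ∧
      nabla E₂ x (S.ξ x) = (-m) • E₂ x ∧
      nabla S.ξ x (E₁ x) = (-c) • E₂ x ∧ nabla E₁ x (E₁ x) = b • E₁ x + c • S.ξ x ∧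
      nabla E₂ x (E₁ x) = (-b) • E₂ x ∧
      nabla S.ξ x (E₂ x) = e • E₁ x ∧ nabla E₁ x (E₂ x) = q • E₁ x ∧
      nabla E₂ x (E₂ x) = (-q) • E₂ x + (-e) • S.ξ x := by
  have s0 := S.smoothOn_ξ U
  have s1 := hF.smoothOn₁
  have s2 := hF.smoothOn₂
  have n1 : ∀ y ∈ U, S.φ y (E₁ y) = (1 : ℝ) • E₁ y := fun y hy => by simpa using hF.φ_E₁ y hy
  have n2 : ∀ y ∈ U, S.φ y (E₂ y) = (-1 : ℝ) • E₂ y := fun y hy => by simpa using hF.φ_E₂ y hy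
  have η1 : ∀ y ∈ U, S.η y (E₁ y) = 0 := fun y hy => S.η_eq_zero_of_φ_eq one_ne_zero (n1 y hy)
  have η2 : ∀ y ∈ U, S.η y (E₂ y) = 0 := fun y hy => S.η_eq_zero_of_φ_eq (by norm_num) (n2 y hy)
  have g00 : ∀ y ∈ U, S.g y (S.ξ y) (S.ξ y) = 1 := fun y _ => by rw [S.g_ξ_right, S.η_ξ]
  have g11 : ∀ y ∈ U, S.g y (E₁ y) (E₁ y) = 0 := fun y hy =>
    S.g_self_eq_zero_of_φ_eq one_ne_zero (n1 y hy)
  have g22 : ∀ y ∈ U, S.g y (E₂ y) (E₂ y) = 0 := fun y hy =>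
    S.g_self_eq_zero_of_φ_eq (by norm_num) (n2 y hy)
  have m00 := hLC.metric_const hU s0 s0 g00 hx
  have m01 := hLC.metric_const hU s0 s1 hF.g_ξ_E₁ hx
  have m02 := hLC.metric_const hU s0 s2 hF.g_ξ_E₂ hx
  have m11 := hLC.metric_const hU s1 s1 g11 hx
  have m12 := hLC.metric_const hU s1 s2 hF.g_E₁_E₂ hx
  have m22 := hLC.metric_const hU s2 s2 g22 hx
  have t01 := hLC.bracket_eq hU s0 s1 hx
  have t02 := hLC.bracket_eq hU s0 s2 hx
  have t12 := hLC.bracket_eq hU s1 s2 hx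
  have b01 := hS.η_bracket_eq_zero hU s0 s1 (fun y _ => S.η_ξ y) η1 hx
  have b02 := hS.η_bracket_eq_zero hU s0 s2 (fun y _ => S.η_ξ y) η2 hx
  have b12 := hS.η_bracket_eq_zero hU s1 s2 η1 η2 hx
  have hφ12 : S.φ x (bracket S.ξ E₁ x) =
      bracket S.ξ E₁ x - (2 * c) • E₂ x := by
    have h2 := S.bracket_phi_eq (X := S.ξ) hU n1 s1 hx
    simp only [h, h2, phi] at hh
    rw [mul_smul, ← hh]
    module
  -- In dimension three this is the only component of `dΦ`. It says `g(∇_{E₁}ξ, E₂) + g(∇_{E₂}ξ, E₁)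
  -- = 0`; `dη = 0` makes the two terms equal, so both vanish.
  have hd := hS.closed_Phi U hU S.ξ E₁ E₂ s0 s1 s2 x hx
  simp only [extDerivPhi, dirDeriv] at hd
  rw [mvfderiv_eq_zero_of_eqOn_const hU (f := S.Phi E₁ E₂) (c := -1)
      (fun y hy => by simp [Phi, hF.φ_E₂ y hy, hF.g_E₁_E₂ y hy]) hx,
    mvfderiv_eq_zero_of_eqOn_const hU (f := S.Phi E₂ S.ξ) (c := 0)
      (fun y hy => by simp [Phi, S.φ_ξ]) hx,
    mvfderiv_eq_zero_of_eqOn_const hU (f := S.Phi S.ξ E₁) (c := 0)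
      (fun y hy => by simp [Phi, hF.φ_E₁ y hy, hF.g_ξ_E₁ y hy]) hx] at hd
  have t20 := hLC.bracket_eq hU s2 s0 hx
  simp only [Phi, hF.φ_E₂ x hx, hF.φ_E₁ x hx, S.φ_ξ, map_neg, map_zero, t01, t20, map_sub,
    sub_apply] at hd
  rw [← S.g_ξ_right, t01, map_sub, sub_apply] at b01
  rw [← S.g_ξ_right, t02, map_sub, sub_apply] at b02
  rw [← S.g_ξ_right, t12, map_sub, sub_apply] at b12
  -- Pairing with `E₁` isolates `g([ξ, E₁], E₁) = c`, that is `g(∇_{E₁}ξ, E₁) = -c`.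
  have hc := congrArg (fun v => S.g x v (E₁ x)) hφ12
  have g21 : S.g x (E₂ x) (E₁ x) = 1 := by rw [S.g_symm, hF.g_E₁_E₂ x hx]
  simp only [S.g_φ_left, hF.φ_E₁ x hx, t01, map_sub, map_smul, sub_apply, smul_apply,
    smul_eq_mul, g21] at hc
  have ex := S.eq_artin_expansion (hF.φ_E₁ x hx) (hF.φ_E₂ x hx) (hF.g_E₁_E₂ x hx)
  refine ⟨S.g x (nabla E₁ x (E₁ x)) (E₂ x), S.g x (nabla E₁ x (S.ξ x)) (E₂ x),
    S.g x (nabla S.ξ x (E₂ x)) (E₂ x), S.g x (nabla E₁ x (E₂ x)) (E₂ x), rfl, ?_⟩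
  have a0 := m00 (S.ξ x); have a1 := m00 (E₁ x); have a2 := m00 (E₂ x)
  have c0 := m01 (S.ξ x); have c1 := m01 (E₁ x); have c2 := m01 (E₂ x)
  have d0 := m02 (S.ξ x); have d1 := m02 (E₁ x); have d2 := m02 (E₂ x)
  have e0 := m11 (S.ξ x); have e1 := m11 (E₁ x); have e2 := m11 (E₂ x)
  have f0 := m12 (S.ξ x); have f1 := m12 (E₁ x); have f2 := m12 (E₂ x)
  have k0 := m22 (S.ξ x); have k1 := m22 (E₁ x); have k2 := m22 (E₂ x)
  refine ⟨?_, ?_, ?_, ?_, ?_, ?_, ?_, ?_, ?_⟩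
  -- Each derivative is expanded in the Artin basis; matching coefficients leaves linear
  -- consequences of the relations above.
  all_goals
    refine (ex _).trans ?_
    match_scalars <;> linarith
end AlmostParacontactMetric
end Paracontact
end

/-! ### The curvature condition in an Artin frame -/

noncomputable section

namespace Paracontact

variable {M : Type*} [TopologicalSpace M] [ChartedSpace E3 M] [IsManifold (𝓡 3) ∞ M]

/-- Evaluates the second derivatives in the curvature: there `Z` is `∇_{Eᵢ}ξ` or `∇_ξ ξ`, a constant
multiple of a frame field on an open set. -/
lemma covariantDerivative_eq_smul
    (nabla : CovariantDerivative (𝓡 3) E3 (TangentSpace (𝓡 3) : M → Type _)) {U : Set M}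
    (hU : IsOpen U) {Y Z : VField M} (hY : SmoothOn Y U) {a : ℝ}
    (h : ∀ x ∈ U, Z x = a • Y x) {x : M} (hx : x ∈ U) : nabla Z x = a • nabla Y x := by
  have haY : SmoothOn (a • Y) U := hY.const_smul a
  have hZ : SmoothOn Z U := haY.congr h
  have hc := nabla.isCovariantDerivativeOn (s := U)
  rw [hc.congr_of_eqOn (hZ.mdifferentiableAt hU hx) (haY.mdifferentiableAt hU hx)
    (hU.mem_nhds hx) h]
  exact hc.smul_const a (hY.mdifferentiableAt hU hx) hx

namespace AlmostParacontactMetric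

variable {S : AlmostParacontactMetric M}
  {nabla : CovariantDerivative (𝓡 3) E3 (TangentSpace (𝓡 3) : M → Type _)}

/-- In an Artin frame with `h E₁ = ε E₂`, the `(κ, μ)`-condition determines the connection up to
the coefficient `b`. -/
lemma IsArtinFrameOn.connection_of_isKappaMuSpace {E₁ E₂ : VField M} {U : Set M}
    (hF : S.IsArtinFrameOn E₁ E₂ U) (hU : IsOpen U) (hLC : IsLeviCivita S.g nabla)
    (hS : S.IsAlmostParacosymplectic) {κ μ : ℝ} (hκμ : S.IsKappaMuSpace nabla κ μ)
    {ε : ℝ} (hε : ε * ε = 1) (hh : ∀ x ∈ U, S.h E₁ x = ε • E₂ x) {x : M} (hx : x ∈ U) :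
    ∃ b : ℝ, b = S.g x (nabla E₁ x (E₁ x)) (E₂ x) ∧
      nabla S.ξ x (S.ξ x) = 0 ∧ nabla E₁ x (S.ξ x) = (-(μ / 2)) • E₁ x ∧
      nabla E₂ x (S.ξ x) = (μ / 2) • E₂ x ∧
      nabla S.ξ x (E₁ x) = (-ε) • E₂ x ∧ nabla E₁ x (E₁ x) = b • E₁ x + ε • S.ξ x ∧
      nabla E₂ x (E₁ x) = (-b) • E₂ x ∧
      nabla S.ξ x (E₂ x) = (ε * κ) • E₁ x ∧ nabla E₁ x (E₂ x) = 0 ∧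
      nabla E₂ x (E₂ x) = (-(ε * κ)) • S.ξ x ∧ (κ ≠ 0 → b = 0) := by
  have s0 := S.smoothOn_ξ U
  have s1 := hF.smoothOn₁
  have s2 := hF.smoothOn₂
  have hε0 : ε ≠ 0 := by rintro rfl; simp at hε
  have η1 : ∀ y ∈ U, S.η y (E₁ y) = 0 := fun y hy =>
    S.η_eq_zero_of_φ_eq one_ne_zero (by simpa using hF.φ_E₁ y hy)
  have η2 : ∀ y ∈ U, S.η y (E₂ y) = 0 := fun y hy =>
    S.η_eq_zero_of_φ_eq (c := -1) (by norm_num) (by simpa using hF.φ_E₂ y hy)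
  have hξ : ∀ y ∈ U, S.h S.ξ y = 0 := by
    intro y _
    have h1 : S.phi S.ξ = 0 := funext fun z => S.φ_ξ z
    simp [h, h1, phi, bracket]
  -- This is `R(ξ, E₁)ξ`, treated at every point of `U`: computing `R(E₁, E₂)ξ` differentiates
  -- `∇_{E₂}ξ = eE₁`, so `e` must first be known to be the constant `εκ` on an open set.
  have key : ∀ y ∈ U, ∃ b m q : ℝ, b = S.g y (nabla E₁ y (E₁ y)) (E₂ y) ∧
      nabla S.ξ y (S.ξ y) = 0 ∧ nabla E₁ y (S.ξ y) = m • E₁ y ∧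
      nabla E₂ y (S.ξ y) = (-m) • E₂ y ∧
      nabla S.ξ y (E₁ y) = (-ε) • E₂ y ∧ nabla E₁ y (E₁ y) = b • E₁ y + ε • S.ξ y ∧
      nabla E₂ y (E₁ y) = (-b) • E₂ y ∧
      nabla S.ξ y (E₂ y) = (ε * κ) • E₁ y ∧ nabla E₁ y (E₂ y) = q • E₁ y ∧
      nabla E₂ y (E₂ y) = (-q) • E₂ y + (-(ε * κ)) • S.ξ y ∧ m = -(μ / 2) := by
    intro y hy
    obtain ⟨b, m, e, q, hb, h00, h01, h02, h10, h11, h12, h20, h21, h22⟩ :=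
      hF.connection hU hLC hS hy (hh y hy)
    have hR := hκμ U hU S.ξ E₁ s0 s1 y hy
    have hξξ : ∀ z ∈ U, covDeriv nabla S.ξ S.ξ z = (0 : ℝ) • S.ξ z := by
      intro z hz
      obtain ⟨b, m, e, q, hb, h00, -⟩ := hF.connection hU hLC hS hz (hh z hz)
      simpa [covDeriv] using h00
    have h1ξ : ∀ z ∈ U, covDeriv nabla E₁ S.ξ z = (-ε) • E₂ z := by
      intro z hz
      obtain ⟨b, m, e, q, hb, h00, h01, h02, h10, -⟩ := hF.connection hU hLC hS hz (hh z hz)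
      exact h10
    rw [curvature, covDeriv, covDeriv, covDeriv, covariantDerivative_eq_smul nabla hU s0 hξξ hy,
      covariantDerivative_eq_smul nabla hU s2 h1ξ hy, hLC.bracket_eq hU s0 s1 hy] at hR
    simp only [eta, S.η_ξ, η1 y hy, hh y hy, hξ y hy, h01, h10, smul_apply, h02, map_sub, map_smul,
      h20] at hR
    have h1 : S.g y (E₁ y) (E₁ y) = 0 :=
      S.g_self_eq_zero_of_φ_eq one_ne_zero (by simpa using hF.φ_E₁ y hy)
    have h2 : S.g y (E₂ y) (E₂ y) = 0 :=
      S.g_self_eq_zero_of_φ_eq (c := -1) (by norm_num) (by simpa using hF.φ_E₂ y hy)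
    have h3 := hF.g_E₁_E₂ y hy
    have h4 : S.g y (E₂ y) (E₁ y) = 1 := by rw [S.g_symm, h3]
    have r1 := congrArg (fun v => S.g y v (E₁ y)) hR
    have r2 := congrArg (fun v => S.g y v (E₂ y)) hR
    simp [h1, h2, h3, h4] at r1 r2
    have he : e = ε * κ := by linear_combination (-e) * hε + ε * r2
    have hm : m = -(μ / 2) := by
      apply mul_left_cancel₀ hε0
      linarith
    subst he
    exact ⟨b, m, q, hb, h00, h01, h02, h10, h11, h12, h20, h21, h22, hm⟩
  obtain ⟨b, m, q, hb, h00, h01, h02, h10, h11, h12, h20, h21, h22, hm⟩ := key x hx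
  have hR := hκμ U hU E₁ E₂ s1 s2 x hx
  have h1ξ : ∀ z ∈ U, covDeriv nabla E₁ S.ξ z = (-ε) • E₂ z := by
    intro z hz
    obtain ⟨b, m, q, hb, h00, h01, h02, h10, -⟩ := key z hz
    exact h10
  have h2ξ : ∀ z ∈ U, covDeriv nabla E₂ S.ξ z = (ε * κ) • E₁ z := by
    intro z hz
    obtain ⟨b, m, q, hb, h00, h01, h02, h10, h11, h12, h20, -⟩ := key z hz
    exact h20
  rw [curvature, covDeriv, covDeriv, covDeriv, covariantDerivative_eq_smul nabla hU s1 h2ξ hx,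
    covariantDerivative_eq_smul nabla hU s2 h1ξ hx, hLC.bracket_eq hU s1 s2 hx] at hR
  simp only [eta, η1 x hx, η2 x hx, smul_apply, h11, h22, h12, h21, map_sub, map_smul,
    h20, h10] at hR
  have h1 : S.g x (E₁ x) (E₁ x) = 0 :=
    S.g_self_eq_zero_of_φ_eq one_ne_zero (by simpa using hF.φ_E₁ x hx)
  have h2 : S.g x (E₂ x) (E₂ x) = 0 :=
    S.g_self_eq_zero_of_φ_eq (c := -1) (by norm_num) (by simpa using hF.φ_E₂ x hx)
  have h3 := hF.g_E₁_E₂ x hx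
  have h4 : S.g x (E₂ x) (E₁ x) = 1 := by rw [S.g_symm, h3]
  have r1 := congrArg (fun v => S.g x v (E₁ x)) hR
  have r2 := congrArg (fun v => S.g x v (E₂ x)) hR
  simp [h1, h2, h3, h4, hF.g_ξ_E₁ x hx, hF.g_ξ_E₂ x hx] at r1 r2
  have hq : q = 0 := by
    apply mul_left_cancel₀ hε0
    linarith
  subst hq hm
  refine ⟨b, hb, h00, h01, ?_, h10, h11, h12, h20, ?_, ?_, fun hκ => ?_⟩
  · simpa using h02
  · simpa using h21
  · simpa using h22
  · have : (ε * κ) * b = 0 := by linarith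
    simpa [hε0, hκ] using this

/-! ### Construction of the frame -/

/-- Normalising a field `X` with `φ X = X` and `h X ≠ 0` to an Artin frame with `h E₁ = ± E₂`. -/
lemma exists_artinFrame [T2Space M] (hS : S.IsAlmostParacosymplectic) {p : M} {V : Set M}
    (hV : IsOpen V) (hpV : p ∈ V) {X : VField M} (hX : SmoothOn X V)
    (hφX : ∀ x ∈ V, S.φ x (X x) = X x) (hhX : ∀ x ∈ V, S.h X x ≠ 0) :
    ∃ (U : Set M) (E₁ E₂ : VField M) (ε : ℝ), IsOpen U ∧ p ∈ U ∧ S.IsArtinFrameOn E₁ E₂ U ∧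
      SmoothOn E₁ Set.univ ∧ (ε = 1 ∨ ε = -1) ∧ ∀ x ∈ U, S.h E₁ x = ε • E₂ x := by
  have hφh : ∀ x ∈ V, S.φ x (S.h X x) = - S.h X x := fun x hx => φ_h_of_φ_eq hS hV hX hφX hx
  have hX0 : ∀ x ∈ V, X x ≠ 0 := by
    intro x hx h0
    apply hhX x hx
    -- By tensoriality `hX` at `x` depends only on `X x`, so a zero of `X` would be a zero of `hX`.
    have h1 := (S.tensorialAt_h x).pointwise (hX.mdifferentiableAt hV hx)
      (Bundle.mdifferentiable_zeroSection ℝ (TangentSpace (𝓡 3) : M → Type _) x) (σ' := 0) h0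
    have h2 := (S.tensorialAt_h x).zero
    exact h1.trans h2
  let G : M → ℝ := fun x => S.g x (X x) (S.h X x)
  have hG : ContMDiffOn (𝓡 3) 𝓘(ℝ, ℝ) ∞ G V := S.contMDiffOn_g hX (SmoothOn.h hV hX)
  have hG0 : ∀ x ∈ V, G x ≠ 0 := fun x hx =>
    S.g_ne_zero_of_φ (hφX x hx) (hφh x hx) (hX0 x hx) (hhX x hx)
  obtain ⟨ε, hε, hεp⟩ : ∃ ε : ℝ, (ε = 1 ∨ ε = -1) ∧ 0 < ε * G p := by
    rcases lt_or_gt_of_ne (hG0 p hpV) with h | h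
    · exact ⟨-1, Or.inr rfl, by linarith⟩
    · exact ⟨1, Or.inl rfl, by linarith⟩
  have hεε : ε * ε = 1 := by rcases hε with rfl | rfl <;> norm_num
  have hεG : ContMDiffOn (𝓡 3) 𝓘(ℝ, ℝ) ∞ (fun x => ε * G x) V :=
    contMDiffOn_const.mul hG
  let W : Set M := V ∩ (fun x => ε * G x) ⁻¹' Set.Ioi 0
  have hW : IsOpen W := hεG.continuousOn.isOpen_inter_preimage hV isOpen_Ioi
  have hpW : p ∈ W := ⟨hpV, hεp⟩
  have hWV : W ⊆ V := Set.inter_subset_left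
  let f : M → ℝ := fun x => (Real.sqrt (ε * G x))⁻¹
  have hf : ContMDiffOn (𝓡 3) 𝓘(ℝ, ℝ) ∞ f W := by
    intro x hx
    have h1 : ContDiffAt ℝ ∞ (fun t : ℝ => (Real.sqrt t)⁻¹) (ε * G x) :=
      (Real.contDiffAt_sqrt (ne_of_gt hx.2)).inv (Real.sqrt_ne_zero'.2 hx.2)
    exact ContMDiffAt.comp_contMDiffWithinAt (f := fun x => ε * G x) x h1.contMDiffAt
      ((hεG.mono hWV) x hx)
  have hff : ∀ x ∈ W, f x * f x * G x = ε := by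
    intro x hx
    have h1 : Real.sqrt (ε * G x) * Real.sqrt (ε * G x) = ε * G x := Real.mul_self_sqrt hx.2.le
    have h2 : Real.sqrt (ε * G x) ≠ 0 := Real.sqrt_ne_zero'.2 hx.2
    have h3 := hG0 x hx.1
    simp only [f]
    rw [← mul_inv, h1]
    have : ε ≠ 0 := by rintro rfl; simp at hεε
    field_simp
    linarith
  have hfX : SmoothOn (fun x => f x • X x) W := SmoothOn.smul hf (hX.mono hWV)
  have hhf : ∀ x ∈ W, S.h (fun x => f x • X x) x = f x • S.h X x := fun x hx =>
    (S.tensorialAt_h x).smul ((hf.contMDiffAt (hW.mem_nhds hx)).mdifferentiableAt (by simp))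
      (hX.mdifferentiableAt hV hx.1)
  -- The smoothness of `nabla` applies to globally smooth fields, so `E₁` is cut off by a bump
  -- function and `U` is taken where that function is `1`. `E₂` needs no extension, as `b`
  -- differentiates only `E₁`.
  obtain ⟨ψ, -, hψ⟩ := (SmoothBumpFunction.nhds_basis_tsupport (I := 𝓡 3) p).mem_iff.1
    (hW.mem_nhds hpW)
  obtain ⟨U, hUψ, hU, hpU⟩ := eventually_nhds_iff.1
    (ψ.eventuallyEq_one.and (hW.mem_nhds hpW))
  have hUW : U ⊆ W := fun x hx => (hUψ x hx).2
  let E₁ : VField M := fun x => ψ x • f x • X x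
  let E₂ : VField M := fun x => ε • f x • S.h X x
  have hE₁U : ∀ x ∈ U, E₁ x = f x • X x := fun x hx => by
    simp only [E₁]
    rw [(hUψ x hx).1]; simp
  have hE₁ : SmoothOn E₁ Set.univ :=
    (ContMDiffOn.smul_section_of_tsupport ψ.contMDiff.contMDiffOn hW hψ hfX).contMDiffOn
  have hE₂ : SmoothOn E₂ U :=
    (SmoothOn.smul (hf.mono hUW) ((SmoothOn.h hV hX).mono (hUW.trans hWV))).const_smul ε
  have hf0 : ∀ x ∈ W, f x ≠ 0 := fun x hx => inv_ne_zero (Real.sqrt_ne_zero'.2 hx.2)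
  have hε0 : ε ≠ 0 := by rintro rfl; simp at hεε
  have hφ1 : ∀ x ∈ U, S.φ x (E₁ x) = E₁ x := fun x hx => by
    rw [hE₁U x hx, map_smul, hφX x (hWV (hUW hx))]
  have hφ2 : ∀ x ∈ U, S.φ x (E₂ x) = - E₂ x := fun x hx => by
    simp only [E₂, map_smul, hφh x (hWV (hUW hx)), smul_neg]
  have hE10 : ∀ x ∈ U, E₁ x ≠ 0 := fun x hx => by
    rw [hE₁U x hx]; exact smul_ne_zero (hf0 x (hUW hx)) (hX0 x (hWV (hUW hx)))
  have hE20 : ∀ x ∈ U, E₂ x ≠ 0 := fun x hx =>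
    smul_ne_zero hε0 (smul_ne_zero (hf0 x (hUW hx)) (hhX x (hWV (hUW hx))))
  have hcons : ∀ x, (fun i => ![S.ξ, E₁, E₂] i x) = ![S.ξ x, E₁ x, E₂ x] := fun x => by
    funext i; fin_cases i <;> rfl
  refine ⟨U, E₁, E₂, ε, hU, hpU, ⟨⟨?_, ?_, ?_⟩, hφ1, hφ2, ?_, ?_, ?_⟩, hE₁, hε, ?_⟩
  · intro x hx
    have h := S.linearIndependent_of_φ (hφ1 x hx) (hφ2 x hx) (hE10 x hx) (hE20 x hx)
    rwa [hcons x]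
  · intro x hx
    have h := S.span_of_φ (hφ1 x hx) (hφ2 x hx) (hE10 x hx) (hE20 x hx)
    rw [hcons x, h]
  · intro i
    fin_cases i
    exacts [S.smoothOn_ξ U, hE₁.mono (Set.subset_univ U), hE₂]
  · intro x hx
    rw [S.g_symm, S.g_ξ_right]
    exact S.η_eq_zero_of_φ_eq one_ne_zero (by simpa using hφ1 x hx)
  · intro x hx
    rw [S.g_symm, S.g_ξ_right]
    exact S.η_eq_zero_of_φ_eq (c := -1) (by norm_num) (by simpa using hφ2 x hx)
  · intro x hx
    have h := hff x (hUW hx)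
    simp only [E₂, hE₁U x hx, map_smul, smul_apply, smul_eq_mul]
    simp only [G] at h
    linear_combination ε * h + hεε
  · intro x hx
    have h1 := (S.tensorialAt_h x).local (hE₁.mdifferentiableAt isOpen_univ trivial)
      (hfX.mdifferentiableAt hW (hUW hx)) (Filter.eventually_of_mem (hU.mem_nhds hx) hE₁U)
    refine h1.trans ((hhf x (hUW hx)).trans ?_)
    simp only [E₂]
    rw [smul_smul, hεε, one_smul]

end AlmostParacontactMetric
end Paracontact
end

/-! ### The main theorem -/

theorem mainTheorem3 {M : Type*} [TopologicalSpace M] [T2Space M] [SecondCountableTopology M]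
    [ChartedSpace E3 M] [IsManifold (𝓡 3) ∞ M]
    (S : Paracontact.AlmostParacontactMetric M)
    (nabla : CovariantDerivative (𝓡 3) E3 (TangentSpace (𝓡 3) : M → Type _))
    (hLC : Paracontact.IsLeviCivita S.g nabla)
    (hS : S.IsAlmostParacosymplectic) (hS' : ¬ S.IsParacosymplectic)
    (κ μ : ℝ) (hκμ : S.IsKappaMuSpace nabla κ μ)
    (p : M) (V : Set M) (hV : IsOpen V) (hpV : p ∈ V)
    (X : Paracontact.VField M) (hX : Paracontact.SmoothOn X V)
    (hφX : ∀ x ∈ V, S.φ x (X x) = X x) (hhX : ∀ x ∈ V, S.h X x ≠ 0) :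
    ∃ (U : Set M) (E₁ E₂ : Paracontact.VField M) (b : M → ℝ) (ε : ℝ),
      IsOpen U ∧ p ∈ U ∧ S.IsArtinFrameOn E₁ E₂ U ∧
      ContMDiffOn (𝓡 3) 𝓘(ℝ, ℝ) ∞ b U ∧ (ε = 1 ∨ ε = -1) ∧
      (∀ x ∈ U,
        Paracontact.covDeriv nabla S.ξ S.ξ x = 0 ∧
        Paracontact.covDeriv nabla S.ξ E₁ x = (-(μ / 2)) • E₁ x ∧
        Paracontact.covDeriv nabla S.ξ E₂ x = (μ / 2) • E₂ x ∧
        Paracontact.covDeriv nabla E₁ S.ξ x = (-ε) • E₂ x ∧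
        Paracontact.covDeriv nabla E₁ E₁ x = b x • E₁ x + ε • S.ξ x ∧
        Paracontact.covDeriv nabla E₁ E₂ x = (-b x) • E₂ x ∧
        Paracontact.covDeriv nabla E₂ S.ξ x = (ε * κ) • E₁ x ∧
        Paracontact.covDeriv nabla E₂ E₁ x = 0 ∧
        Paracontact.covDeriv nabla E₂ E₂ x = (-(ε * κ)) • S.ξ x) ∧
      (κ ≠ 0 → ∀ x ∈ U, b x = 0) := by
  obtain ⟨U, E₁, E₂, ε, hU, hpU, hF, hE₁, hε, hh⟩ :=
    Paracontact.AlmostParacontactMetric.exists_artinFrame hS hV hpV hX hφX hhX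
  have hεε : ε * ε = 1 := by rcases hε with rfl | rfl <;> norm_num
  have key := fun x (hx : x ∈ U) =>
    hF.connection_of_isKappaMuSpace hU hLC hS hκμ hεε hh (x := x) hx
  refine ⟨U, E₁, E₂, fun x => S.g x (nabla E₁ x (E₁ x)) (E₂ x), ε, hU, hpU, hF, ?_, hε, ?_, ?_⟩
  · refine S.contMDiffOn_g (X := fun x => nabla E₁ x (E₁ x)) ?_ hF.smoothOn₂
    -- Here the global smoothness of `E₁` is used: `∇E₁` is then a smooth endomorphism field.
    exact ContMDiffOn.clm_bundle_apply
      ((hLC.smooth.contMDiff.contMDiff (σ := E₁) (by simpa [Paracontact.SmoothOn] using hE₁)).mono (Set.subset_univ U))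
      hF.smoothOn₁
  · intro x hx
    obtain ⟨b, rfl, h00, h01, h02, h10, h11, h12, h20, h21, h22, -⟩ := key x hx
    exact ⟨h00, h01, h02, h10, h11, h12, h20, h21, h22⟩
  · intro hκ x hx
    obtain ⟨b, rfl, -, -, -, -, -, -, -, -, -, hb⟩ := key x hx
    exact hb hκ
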